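/- Let $\alpha,\beta>-1$ be real, and for $k\ge 0$ let $P^{\alpha,\beta}_k$ be the Jacobi polynomial of degree $k$, i.e. the polynomial of degree $k$ (unique up to a nonzero constant factor) that is orthogonal to all polynomials of smaller degree with respect to the weight function $(1-x)^\alpha(1+x)^\beta$ on $(-1,1)$. Then for every $k\ge 1$ the polynomial $P^{\alpha,\beta}_k$ has a smallest real root $\xi^{\alpha,\beta}_k$, and $$\xi^{\alpha,\beta}_k=-1+\Theta\left(\frac1{k^2}\right)\quad\text{as } k\to\infty,$$ that is, there are constants $c,C>0$, depending only on $\alpha$ and $\beta$, such that $$-1+\frac{c}{k^2}\le \xi^{\alpha,\beta}_k\le -1+\frac{C}{k^2}\quad\text{for all sufficiently large } k.$$ -/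

import Mathlib

open Polynomial

/-- The Jacobi weight function `w(x) = (1 - x)^α (1 + x)^β`, used on `(-1, 1)`. -/
noncomputable def jacobiWeight (α β x : ℝ) : ℝ := (1 - x) ^ α * (1 + x) ^ β

/-- The inner product `⟨p, q⟩ = ∫_{-1}^{1} p(x) q(x) w(x) dx` for the Jacobi weight. The integral
is absolutely convergent for all polynomials when `α, β > -1`. -/
noncomputable def jacobiInner (α β : ℝ) (p q : ℝ[X]) : ℝ :=
  ∫ x in (-1 : ℝ)..1, p.eval x * q.eval x * jacobiWeight α β x

/-- The monic orthogonal polynomial of degree `k` for the Jacobi weight, obtained by the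
Gram-Schmidt process from the monomials `1, X, X ^ 2, …`. -/
noncomputable def jacobiMonic (α β : ℝ) (k : ℕ) : ℝ[X] :=
  X ^ k - ∑ j : Fin k,
    C (jacobiInner α β (X ^ k) (jacobiMonic α β j) /
        jacobiInner α β (jacobiMonic α β j) (jacobiMonic α β j)) * jacobiMonic α β j
termination_by k
decreasing_by all_goals exact j.isLt

/-- The leading coefficient of the Jacobi polynomial of degree `k` in its classical normalization:
`(k + α + β + 1) (k + α + β + 2) ⋯ (2 k + α + β) / (2 ^ k k!)`.
It is positive when `α, β > -1`. -/
noncomputable def jacobiLeadingCoeff (α β : ℝ) (k : ℕ) : ℝ :=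
  (∏ j ∈ Finset.range k, ((k : ℝ) + α + β + ((j : ℝ) + 1))) / (2 ^ k * (k.factorial : ℝ))

/-- The Jacobi polynomial of degree `k`: the orthogonal polynomial of degree `k` with respect to
the weight `(1 - x)^α (1 + x)^β` on `(-1, 1)`, in its classical normalization. Orthogonality
determines it up to a nonzero factor, so that its roots do not depend on the normalization. -/
noncomputable def jacobiPoly (α β : ℝ) (k : ℕ) : ℝ[X] :=
  C (jacobiLeadingCoeff α β k) * jacobiMonic α β k

/-- The smallest root of the Jacobi polynomial of degree `k`. It is meaningful for `k ≥ 1`. -/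
noncomputable def jacobiSmallestRoot (α β : ℝ) (k : ℕ) : ℝ :=
  sInf {x : ℝ | (jacobiPoly α β k).IsRoot x}

/-! Let `r` run over the roots of the orthogonal polynomial `P` of degree `k`. Orthogonality makes
them all real and greater than -1, so the numbers `1/(1+r)` are positive, and the largest of them is
`1/(1+ξ)`. With `S` their sum and `T` the sum of their squares, this gives `T/S ≤ 1/(1+ξ) ≤ S`. Both
sums are explicit: `P'/P = -S` and `P''/P = S² - T` at -1, while the Jacobi differential equation
and its derivative, evaluated at the singular point -1, express these ratios through `k`, `α`, `β`
(`sum_inv_one_add_roots_jacobiMonic`). Both `S` and `T/S` turn out to be of order `k²`. -/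

/-- The moment functional `p ↦ ∫_{-1}^{1} p(x) w(x) dx` of the Jacobi weight. -/
noncomputable def jacobiFunctional (α β : ℝ) (p : ℝ[X]) : ℝ :=
  ∫ x in (-1 : ℝ)..1, p.eval x * jacobiWeight α β x

theorem jacobiInner_eq_functional (α β : ℝ) (p q : ℝ[X]) :
    jacobiInner α β p q = jacobiFunctional α β (p * q) := by
  simp [jacobiInner, jacobiFunctional, eval_mul]

/-! ### Integration against the Jacobi weight -/

section Functional

variable {α β : ℝ}

theorem jacobiWeight_pos {x : ℝ} (hx : x ∈ Set.Ioo (-1 : ℝ) 1) : 0 < jacobiWeight α β x :=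
  mul_pos (Real.rpow_pos_of_pos (by linarith [hx.2]) _)
    (Real.rpow_pos_of_pos (by linarith [hx.1]) _)

theorem intervalIntegrable_jacobiWeight (hα : -1 < α) (hβ : -1 < β) :
    IntervalIntegrable (jacobiWeight α β) MeasureTheory.volume (-1) 1 := by
  have h1 : IntervalIntegrable (fun x : ℝ => (1 + x) ^ β) MeasureTheory.volume (-1) 0 := by
    simpa using (intervalIntegral.intervalIntegrable_rpow' (a := 0) (b := 1) hβ).comp_add_left 1
  have h2 : IntervalIntegrable (fun x : ℝ => (1 - x) ^ α) MeasureTheory.volume 0 1 := by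
    simpa using
      (intervalIntegral.intervalIntegrable_rpow' (a := 1) (b := 0) hα).comp_sub_left 1
  refine IntervalIntegrable.trans (b := 0) ?_ ?_
  · refine h1.continuousOn_mul (f := fun x : ℝ => (1 + x) ^ β) (g := fun x : ℝ => (1 - x) ^ α) ?_
    rw [Set.uIcc_of_le (by norm_num)]
    exact ContinuousOn.rpow_const (by fun_prop) fun x hx => Or.inl (by linarith [hx.2])
  · refine h2.mul_continuousOn (f := fun x : ℝ => (1 - x) ^ α) (g := fun x : ℝ => (1 + x) ^ β) ?_
    rw [Set.uIcc_of_le (by norm_num)]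
    exact ContinuousOn.rpow_const (by fun_prop) fun x hx => Or.inl (by linarith [hx.1])

theorem intervalIntegrable_eval_mul_jacobiWeight (hα : -1 < α) (hβ : -1 < β) (p : ℝ[X]) :
    IntervalIntegrable (fun x => p.eval x * jacobiWeight α β x) MeasureTheory.volume (-1) 1 :=
  (intervalIntegrable_jacobiWeight hα hβ).continuousOn_mul p.continuous.continuousOn

theorem jacobiFunctional_add (hα : -1 < α) (hβ : -1 < β) (p q : ℝ[X]) :
    jacobiFunctional α β (p + q) = jacobiFunctional α β p + jacobiFunctional α β q := by
  unfold jacobiFunctional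
  rw [← intervalIntegral.integral_add (intervalIntegrable_eval_mul_jacobiWeight hα hβ p)
    (intervalIntegrable_eval_mul_jacobiWeight hα hβ q)]
  simp [add_mul]

theorem jacobiFunctional_C_mul (c : ℝ) (p : ℝ[X]) :
    jacobiFunctional α β (C c * p) = c * jacobiFunctional α β p := by
  unfold jacobiFunctional
  rw [← intervalIntegral.integral_const_mul]
  simp [mul_assoc]

theorem jacobiFunctional_neg (p : ℝ[X]) :
    jacobiFunctional α β (-p) = -jacobiFunctional α β p := by
  simpa using jacobiFunctional_C_mul (α := α) (β := β) (-1) p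

theorem jacobiFunctional_sub (hα : -1 < α) (hβ : -1 < β) (p q : ℝ[X]) :
    jacobiFunctional α β (p - q) = jacobiFunctional α β p - jacobiFunctional α β q := by
  rw [sub_eq_add_neg, jacobiFunctional_add hα hβ, jacobiFunctional_neg, sub_eq_add_neg]

theorem jacobiFunctional_sum (hα : -1 < α) (hβ : -1 < β) {ι : Type*} (s : Finset ι)
    (f : ι → ℝ[X]) :
    jacobiFunctional α β (∑ i ∈ s, f i) = ∑ i ∈ s, jacobiFunctional α β (f i) := by
  classical
  induction s using Finset.induction_on with
  | empty => simp [jacobiFunctional]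
  | insert a s ha ih => rw [Finset.sum_insert ha, Finset.sum_insert ha, jacobiFunctional_add hα hβ,
      ih]

theorem jacobiFunctional_pos (hα : -1 < α) (hβ : -1 < β) {p : ℝ[X]} (hp : p ≠ 0)
    (hnn : ∀ x ∈ Set.Ioo (-1 : ℝ) 1, 0 ≤ p.eval x) : 0 < jacobiFunctional α β p := by
  unfold jacobiFunctional
  rw [intervalIntegral.integral_pos_iff_support_of_nonneg_ae' _
    (intervalIntegrable_eval_mul_jacobiWeight hα hβ p)]
  · refine ⟨by norm_num, ?_⟩
    have hfin : MeasureTheory.volume {x : ℝ | p.IsRoot x} = 0 :=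
      (finite_setOfPred_isRoot hp).measure_zero _
    have hsub : Set.Ioo (-1 : ℝ) 1 \ {x | p.IsRoot x} ⊆
        (Function.support fun x => p.eval x * jacobiWeight α β x) ∩ Set.Ioc (-1) 1 :=
      fun x hx => ⟨mul_ne_zero hx.2 (jacobiWeight_pos hx.1).ne', Set.Ioo_subset_Ioc_self hx.1⟩
    refine lt_of_lt_of_le ?_ (MeasureTheory.measure_mono hsub)
    rw [MeasureTheory.measure_sdiff_null hfin, Real.volume_Ioo]
    norm_num
  · rw [Set.uIoc_of_le (by norm_num), Filter.EventuallyLE,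
      ← MeasureTheory.restrict_Ioo_eq_restrict_Ioc,
      MeasureTheory.ae_restrict_iff' measurableSet_Ioo]
    exact .of_forall fun x hx => mul_nonneg (hnn x hx) (jacobiWeight_pos hx).le

/-- The Pearson equation of the Jacobi weight, in integrated form. -/
theorem jacobiFunctional_pearson (hα : -1 < α) (hβ : -1 < β) (p : ℝ[X]) :
    jacobiFunctional α β
      ((1 - X ^ 2) * derivative p + (C (β - α) - C (α + β + 2) * X) * p) = 0 := by
  -- The integrand is an exact derivative; the exponents `α + 1`, `β + 1` are positive, so the
  -- boundary terms vanish.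
  have key := intervalIntegral.integral_eq_sub_of_hasDerivAt_of_le (a := (-1 : ℝ)) (b := 1)
    (f := fun x => p.eval x * ((1 - x) ^ (α + 1) * (1 + x) ^ (β + 1)))
    (by norm_num) ?_ ?_ (intervalIntegrable_eval_mul_jacobiWeight hα hβ
      ((1 - X ^ 2) * derivative p + (C (β - α) - C (α + β + 2) * X) * p))
  · unfold jacobiFunctional
    rw [key]
    simp [Real.zero_rpow (show α + 1 ≠ 0 by linarith), Real.zero_rpow (show β + 1 ≠ 0 by linarith)]
  · refine p.continuous.continuousOn.mul (ContinuousOn.mul ?_ ?_)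
    · exact ContinuousOn.rpow_const (by fun_prop) fun x hx => Or.inr (by linarith)
    · exact ContinuousOn.rpow_const (by fun_prop) fun x hx => Or.inr (by linarith)
  · intro x hx
    have h1 : 0 < 1 - x := by linarith [hx.2]
    have h2 : 0 < 1 + x := by linarith [hx.1]
    have d1 : HasDerivAt (fun x : ℝ => (1 - x) ^ (α + 1)) (-1 * (α + 1) * (1 - x) ^ α) x := by
      simpa using ((hasDerivAt_id x).const_sub 1).rpow_const (p := α + 1) (Or.inl h1.ne')
    have d2 : HasDerivAt (fun x : ℝ => (1 + x) ^ (β + 1)) (1 * (β + 1) * (1 + x) ^ β) x := by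
      simpa using ((hasDerivAt_id x).const_add 1).rpow_const (p := β + 1) (Or.inl h2.ne')
    refine ((p.hasDerivAt x).mul (d1.mul d2)).congr_deriv ?_
    simp only [jacobiWeight, Real.rpow_add h1, Real.rpow_add h2, Real.rpow_one, Pi.mul_apply,
      eval_add, eval_mul, eval_sub, eval_one, eval_pow, eval_X, eval_C]
    ring

end Functional

/-! ### Orthogonality and real-rootedness -/

section Monic

theorem natDegree_and_monic_jacobiMonic (α β : ℝ) (k : ℕ) :
    (jacobiMonic α β k).Monic ∧ (jacobiMonic α β k).natDegree = k := by
  induction k using Nat.strong_induction_on with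
  | _ k ih =>
    have hdeg : (∑ j : Fin k, C (jacobiInner α β (X ^ k) (jacobiMonic α β j) /
        jacobiInner α β (jacobiMonic α β j) (jacobiMonic α β j)) *
          jacobiMonic α β j).degree < (k : WithBot ℕ) := by
      refine (degree_sum_le _ _).trans_lt ((Finset.sup_lt_iff (WithBot.bot_lt_coe k)).2 ?_)
      intro j _
      rw [← smul_eq_C_mul]
      refine (degree_smul_le _ _).trans_lt ?_
      rw [degree_eq_natDegree (ih j j.isLt).1.ne_zero, (ih j j.isLt).2]
      exact Nat.cast_lt.mpr j.isLt
    rw [jacobiMonic]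
    have hm := monic_X_pow_sub hdeg
    refine ⟨hm, ?_⟩
    rw [natDegree_eq_of_degree_eq_some]
    rw [degree_sub_eq_left_of_degree_lt (by rwa [degree_X_pow]), degree_X_pow]

theorem jacobiMonic_monic (α β : ℝ) (k : ℕ) : (jacobiMonic α β k).Monic :=
  (natDegree_and_monic_jacobiMonic α β k).1

@[simp]
theorem natDegree_jacobiMonic (α β : ℝ) (k : ℕ) : (jacobiMonic α β k).natDegree = k :=
  (natDegree_and_monic_jacobiMonic α β k).2

variable {α β : ℝ}

theorem jacobiFunctional_mul_self_pos (hα : -1 < α) (hβ : -1 < β) {p : ℝ[X]} (hp : p ≠ 0) :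
    0 < jacobiFunctional α β (p * p) :=
  jacobiFunctional_pos hα hβ (mul_ne_zero hp hp) fun x _ => by
    rw [eval_mul]
    exact mul_self_nonneg _

theorem jacobiFunctional_jacobiMonic_mul_of_lt (hα : -1 < α) (hβ : -1 < β) {k i : ℕ}
    (hi : i < k) : jacobiFunctional α β (jacobiMonic α β k * jacobiMonic α β i) = 0 := by
  induction k using Nat.strong_induction_on generalizing i with
  | _ k ih =>
    rw [jacobiMonic, sub_mul, jacobiFunctional_sub hα hβ, Finset.sum_mul,
      jacobiFunctional_sum hα hβ, Finset.sum_eq_single ⟨i, hi⟩]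
    · have hpos := jacobiFunctional_mul_self_pos hα hβ (jacobiMonic_monic α β i).ne_zero
      rw [mul_assoc, jacobiFunctional_C_mul, jacobiInner_eq_functional, jacobiInner_eq_functional,
        div_mul_cancel₀ _ hpos.ne', sub_self]
    · intro j _ hj
      rw [mul_assoc, jacobiFunctional_C_mul]
      have hne : (j : ℕ) ≠ i := fun h => hj (Fin.ext h)
      rcases lt_or_gt_of_ne hne with h | h
      · rw [mul_comm (jacobiMonic α β j), ih i hi h, mul_zero]
      · rw [ih j j.isLt h, mul_zero]
    · simp

theorem jacobiFunctional_jacobiMonic_mul (hα : -1 < α) (hβ : -1 < β) {k : ℕ} {q : ℝ[X]}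
    (hq : q.degree < k) : jacobiFunctional α β (jacobiMonic α β k * q) = 0 := by
  suffices H : ∀ n ≤ k, ∀ q : ℝ[X], q.degree < n →
      jacobiFunctional α β (jacobiMonic α β k * q) = 0 from H k le_rfl q hq
  intro n
  induction n with
  | zero =>
    intro _ q hq
    have : q = 0 := by simpa using hq
    simp [this, jacobiFunctional]
  | succ n ih =>
    intro hn q hq
    have hm := jacobiMonic_monic α β n
    have hdm : (jacobiMonic α β n).degree = n := by
      rw [degree_eq_natDegree hm.ne_zero, natDegree_jacobiMonic]
    -- Removing the top coefficient of `q` with a lower orthogonal polynomial reduces the degree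
    -- bound.
    have hdec : jacobiMonic α β k * q = jacobiMonic α β k * (q - C (q.coeff n) * jacobiMonic α β n)
        + C (q.coeff n) * (jacobiMonic α β k * jacobiMonic α β n) := by ring
    rw [hdec, jacobiFunctional_add hα hβ, jacobiFunctional_C_mul,
      jacobiFunctional_jacobiMonic_mul_of_lt hα hβ hn, mul_zero, add_zero]
    refine ih (by omega) _ ?_
    rw [degree_lt_iff_coeff_zero]
    intro m hnm
    rw [coeff_sub, coeff_C_mul]
    rcases hnm.eq_or_lt with rfl | h
    · have : (jacobiMonic α β n).coeff n = 1 := by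
        simpa using hm.coeff_natDegree
      rw [this]; ring
    · rw [coeff_eq_zero_of_degree_lt (hq.trans_le (by exact_mod_cast h)),
        coeff_eq_zero_of_degree_lt (p := jacobiMonic α β n) (by rw [hdm]; exact_mod_cast h)]
      simp

/-- If a nonconstant polynomial divides an orthogonal polynomial then it is not of constant sign
on `(-1, 1)`. -/
theorem not_nonneg_of_dvd_jacobiMonic (hα : -1 < α) (hβ : -1 < β) {k : ℕ} {f : ℝ[X]}
    (hf : 0 < f.natDegree) (hdvd : f ∣ jacobiMonic α β k) :
    ¬ ∀ x ∈ Set.Ioo (-1 : ℝ) 1, 0 ≤ f.eval x := by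
  intro hnn
  obtain ⟨q, hq⟩ := hdvd
  have hP := (jacobiMonic_monic α β k).ne_zero
  have hf0 : f ≠ 0 := by rintro rfl; simp at hf
  have hq0 : q ≠ 0 := by rintro rfl; simp [hP] at hq
  have hdeg : q.degree < k := by
    have h := congrArg natDegree hq
    rw [natDegree_jacobiMonic, natDegree_mul hf0 hq0] at h
    rw [degree_eq_natDegree hq0]
    exact_mod_cast (by omega : q.natDegree < k)
  have h0 := jacobiFunctional_jacobiMonic_mul hα hβ hdeg
  -- With `P = f q`, pairing `P` with `q` integrates `f q²`, which is positive if `f ≥ 0`; yet `deg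
  -- q < k` forces zero.
  have hpos : 0 < jacobiFunctional α β (f * q * q) := by
    refine jacobiFunctional_pos hα hβ (mul_ne_zero (mul_ne_zero hf0 hq0) hq0) fun x hx => ?_
    rw [eval_mul, eval_mul, mul_assoc]
    exact mul_nonneg (hnn x hx) (mul_self_nonneg _)
  rw [hq] at h0
  exact hpos.ne' h0

theorem neg_one_lt_of_isRoot_jacobiMonic (hα : -1 < α) (hβ : -1 < β) {k : ℕ} {x : ℝ}
    (hx : (jacobiMonic α β k).IsRoot x) : -1 < x := by
  by_contra! h
  refine not_nonneg_of_dvd_jacobiMonic hα hβ (by simp) (dvd_iff_isRoot.mpr hx) fun y hy => ?_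
  simp only [eval_sub, eval_X, eval_C]
  linarith [hy.1]

theorem exists_isRoot_of_dvd_jacobiMonic (hα : -1 < α) (hβ : -1 < β) {k : ℕ} {f : ℝ[X]}
    (hf : 0 < f.natDegree) (hdvd : f ∣ jacobiMonic α β k) : ∃ x, f.IsRoot x := by
  have h1 := not_nonneg_of_dvd_jacobiMonic hα hβ hf hdvd
  have h2 := not_nonneg_of_dvd_jacobiMonic hα hβ (f := -f) (by simpa using hf) (by simpa using hdvd)
  push Not at h1 h2
  obtain ⟨a, -, ha⟩ := h1
  obtain ⟨b, -, hb⟩ := h2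
  rw [eval_neg, neg_lt_zero] at hb
  obtain ⟨x, hx⟩ := mem_range_of_exists_le_of_exists_ge f.continuous ⟨a, ha.le⟩ ⟨b, hb.le⟩
  exact ⟨x, hx⟩

/-- Every irreducible factor changes sign, hence has a real root, hence is linear. -/
theorem jacobiMonic_splits (hα : -1 < α) (hβ : -1 < β) (k : ℕ) :
    (jacobiMonic α β k).Splits := by
  have hP := (jacobiMonic_monic α β k).ne_zero
  obtain ⟨u, hu⟩ := UniqueFactorizationMonoid.factors_prod hP
  rw [← hu]
  refine (Splits.multisetProd fun g hg => ?_).mul u.isUnit.splits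
  have hirr := UniqueFactorizationMonoid.irreducible_of_factor g hg
  obtain ⟨x, hx⟩ := exists_isRoot_of_dvd_jacobiMonic hα hβ hirr.natDegree_pos
    (UniqueFactorizationMonoid.dvd_of_mem_factors hg)
  exact Splits.of_degree_eq_one (degree_eq_one_of_irreducible_of_root hirr hx)

end Monic

/-! ### The Jacobi differential equation -/

section ODE

/-- The Jacobi differential operator `p ↦ (1 - x²) p'' + (β - α - (α + β + 2) x) p'`. -/
noncomputable def jacobiOperator (α β : ℝ) (p : ℝ[X]) : ℝ[X] :=
  (1 - X ^ 2) * derivative (derivative p) + (C (β - α) - C (α + β + 2) * X) * derivative p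

variable {α β : ℝ}

/-- Integration by parts, i.e. Pearson for `p' q`. The right side is symmetric in `p` and `q`, so
the operator is self-adjoint. -/
theorem jacobiFunctional_jacobiOperator_mul (hα : -1 < α) (hβ : -1 < β) (p q : ℝ[X]) :
    jacobiFunctional α β (jacobiOperator α β p * q) =
      -jacobiFunctional α β ((1 - X ^ 2) * (derivative p * derivative q)) := by
  have h := jacobiFunctional_pearson hα hβ (derivative p * q)
  rw [derivative_mul] at h
  rw [eq_neg_iff_add_eq_zero, ← jacobiFunctional_add hα hβ, ← h, jacobiOperator]
  congr 1
  ring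

theorem jacobiFunctional_jacobiOperator_mul_comm (hα : -1 < α) (hβ : -1 < β) (p q : ℝ[X]) :
    jacobiFunctional α β (jacobiOperator α β p * q) =
      jacobiFunctional α β (p * jacobiOperator α β q) := by
  rw [mul_comm p, jacobiFunctional_jacobiOperator_mul hα hβ,
    jacobiFunctional_jacobiOperator_mul hα hβ, mul_comm (derivative p)]

theorem coeff_jacobiOperator (p : ℝ[X]) (n : ℕ) :
    (jacobiOperator α β p).coeff n = (n + 2) * (n + 1) * p.coeff (n + 2)
      + (β - α) * (n + 1) * p.coeff (n + 1) - n * (n + α + β + 1) * p.coeff n := by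
  have h : jacobiOperator α β p = derivative (derivative p) - X * (X * derivative (derivative p))
      + C (β - α) * derivative p - C (α + β + 2) * (X * derivative p) := by
    rw [jacobiOperator]; ring
  rw [h]
  rcases n with _ | _ | n <;>
  · simp only [coeff_add, coeff_sub, coeff_C_mul, coeff_X_mul, coeff_X_mul_zero, coeff_derivative]
    push_cast
    ring

theorem degree_jacobiOperator_lt {n : ℕ} {p : ℝ[X]} (hp : p.degree < n) :
    (jacobiOperator α β p).degree < n := by
  rw [degree_lt_iff_coeff_zero] at hp ⊢
  intro m hm
  rw [coeff_jacobiOperator, hp _ hm, hp _ (by omega), hp _ (by omega)]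
  ring

/-- The Jacobi differential equation. -/
theorem jacobiOperator_jacobiMonic (hα : -1 < α) (hβ : -1 < β) (k : ℕ) :
    jacobiOperator α β (jacobiMonic α β k) + C (k * (k + α + β + 1)) * jacobiMonic α β k = 0 := by
  set P := jacobiMonic α β k with hPdef
  set R := jacobiOperator α β P + C (k * (k + α + β + 1)) * P with hR
  have hcoeff : ∀ m, k < m → P.coeff m = 0 := fun m hm =>
    coeff_eq_zero_of_natDegree_lt (by simpa [hPdef] using hm)
  have hdeg : R.degree < k := by
    rw [degree_lt_iff_coeff_zero]
    intro m hm
    rw [hR, coeff_add, coeff_C_mul, coeff_jacobiOperator, hcoeff _ (by omega : k < m + 2),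
      hcoeff _ (by omega : k < m + 1)]
    rcases hm.eq_or_lt with rfl | h
    · ring
    · rw [hcoeff m h]; ring
  by_contra hne
  -- The top coefficients cancel in `R`, so `deg R < k`. The operator is symmetric and does not
  -- raise degrees, so `R` is orthogonal to itself.
  refine (jacobiFunctional_mul_self_pos hα hβ hne).ne' ?_
  conv_lhs => rw [hR, add_mul]
  rw [jacobiFunctional_add hα hβ, jacobiFunctional_jacobiOperator_mul_comm hα hβ, mul_assoc,
    jacobiFunctional_C_mul, jacobiFunctional_jacobiMonic_mul hα hβ hdeg,
    jacobiFunctional_jacobiMonic_mul hα hβ (degree_jacobiOperator_lt hdeg)]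
  ring

/-- At -1 the coefficient `1 - x²` of `P''` vanishes, leaving a relation between `P'` and `P`. -/
theorem eval_neg_one_derivative_jacobiMonic (hα : -1 < α) (hβ : -1 < β) (k : ℕ) :
    2 * (β + 1) * (derivative (jacobiMonic α β k)).eval (-1) =
      -(k * (k + α + β + 1)) * (jacobiMonic α β k).eval (-1) := by
  have h := congrArg (eval (-1)) (jacobiOperator_jacobiMonic hα hβ k)
  simp [jacobiOperator] at h
  linarith

theorem eval_neg_one_derivative_derivative_jacobiMonic (hα : -1 < α) (hβ : -1 < β) (k : ℕ) :
    2 * (β + 2) * (derivative (derivative (jacobiMonic α β k))).eval (-1) =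
      -(k * (k + α + β + 1) - (α + β + 2)) * (derivative (jacobiMonic α β k)).eval (-1) := by
  have h := congrArg (fun p => eval (-1) (derivative p)) (jacobiOperator_jacobiMonic hα hβ k)
  simp [jacobiOperator, derivative_mul] at h
  linarith

end ODE

/-! ### Power sums of the reciprocals `1/(1+r)` -/

section Roots

/-- The first two logarithmic derivatives of a product of linear factors. -/
theorem eval_derivatives_prod_X_sub_C {K : Type*} [Field K] (s : Multiset K) (a : K)
    (ha : ∀ r ∈ s, a ≠ r) :
    (derivative (s.map (X - C ·)).prod).eval a =
        ((s.map (X - C ·)).prod).eval a * (s.map fun r => (a - r)⁻¹).sum ∧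
    (derivative (derivative (s.map (X - C ·)).prod)).eval a =
        ((s.map (X - C ·)).prod).eval a *
          ((s.map fun r => (a - r)⁻¹).sum ^ 2 - (s.map fun r => (a - r)⁻¹ ^ 2).sum) := by
  induction s using Multiset.induction_on with
  | empty => simp
  | cons r s ih =>
    obtain ⟨h1, h2⟩ := ih fun x hx => ha x (Multiset.mem_cons_of_mem hx)
    have hr : a - r ≠ 0 := sub_ne_zero.mpr (ha r (Multiset.mem_cons_self r s))
    simp only [Multiset.map_cons, Multiset.prod_cons, Multiset.sum_cons, derivative_mul,
      derivative_sub, derivative_X, derivative_C, derivative_add, sub_zero, one_mul, eval_add,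
      eval_mul, eval_sub, eval_X, eval_C, h1, h2]
    constructor
    · field_simp
    · field_simp
      ring

variable {α β : ℝ}

theorem sum_inv_one_add_roots_jacobiMonic (hα : -1 < α) (hβ : -1 < β) (k : ℕ) :
    ((jacobiMonic α β k).roots.map fun r => (1 + r)⁻¹).sum =
        k * (k + α + β + 1) / (2 * (β + 1)) ∧
    ((jacobiMonic α β k).roots.map fun r => (1 + r)⁻¹ ^ 2).sum =
        k * (k + α + β + 1) / (2 * (β + 1)) *
          ((k * (k + α + β + 1) + (β + 1) * (α + β + 2)) / (2 * (β + 1) * (β + 2))) := by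
  have hP := (jacobiMonic_monic α β k).ne_zero
  have hgt : ∀ r ∈ (jacobiMonic α β k).roots, -1 < r := fun r hr =>
    neg_one_lt_of_isRoot_jacobiMonic hα hβ ((mem_roots hP).mp hr)
  have hP1 : (jacobiMonic α β k).eval (-1) ≠ 0 := fun h =>
    lt_irrefl _ (neg_one_lt_of_isRoot_jacobiMonic hα hβ h)
  obtain ⟨h1, h2⟩ := eval_derivatives_prod_X_sub_C (jacobiMonic α β k).roots (-1)
    fun r hr => (hgt r hr).ne
  rw [← (jacobiMonic_splits hα hβ k).eq_prod_roots_of_monic (jacobiMonic_monic α β k)] at h1 h2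
  have e1 : ((jacobiMonic α β k).roots.map fun r => (-1 - r)⁻¹).sum =
      -((jacobiMonic α β k).roots.map fun r => (1 + r)⁻¹).sum := by
    rw [← Multiset.sum_map_neg]
    congr 1
    refine Multiset.map_congr rfl fun r _ => ?_
    rw [← inv_neg]; ring_nf
  have e2 : ((jacobiMonic α β k).roots.map fun r => (-1 - r)⁻¹ ^ 2).sum =
      ((jacobiMonic α β k).roots.map fun r => (1 + r)⁻¹ ^ 2).sum := by
    congr 1
    refine Multiset.map_congr rfl fun r _ => ?_
    rw [← neg_sq, ← inv_neg]; ring_nf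
  have d1 := eval_neg_one_derivative_jacobiMonic hα hβ k
  have d2 := eval_neg_one_derivative_derivative_jacobiMonic hα hβ k
  rw [e1] at h1
  rw [e1, e2] at h2
  rw [h2, h1] at d2
  rw [h1] at d1
  set S := ((jacobiMonic α β k).roots.map fun r => (1 + r)⁻¹).sum
  set T := ((jacobiMonic α β k).roots.map fun r => (1 + r)⁻¹ ^ 2).sum
  set v := (jacobiMonic α β k).eval (-1)
  have hb : (β + 1) ≠ 0 := by linarith
  have hb2 : (β + 2) ≠ 0 := by linarith
  have hS : S = k * (k + α + β + 1) / (2 * (β + 1)) := by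
    rw [eq_div_iff (by positivity)]
    apply mul_left_cancel₀ hP1
    linarith
  refine ⟨hS, ?_⟩
  have hT : 2 * (β + 2) * (S ^ 2 - T) = (k * (k + α + β + 1) - (α + β + 2)) * S := by
    apply mul_left_cancel₀ hP1
    linarith
  have hT' : T = S ^ 2 - (k * (k + α + β + 1) - (α + β + 2)) * S / (2 * (β + 2)) := by
    field_simp
    linarith
  rw [hT', hS]
  field_simp
  ring

end Roots

/-! ### Bounds for the smallest root -/

section SmallestRoot

variable {α β : ℝ}

theorem jacobiLeadingCoeff_pos (hα : -1 < α) (hβ : -1 < β) {k : ℕ} (hk : 1 ≤ k) :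
    0 < jacobiLeadingCoeff α β k := by
  refine div_pos (Finset.prod_pos fun j _ => ?_) (by positivity)
  have h1 : (1 : ℝ) ≤ k := by exact_mod_cast hk
  have h2 : (0 : ℝ) ≤ j := j.cast_nonneg
  linarith

theorem isRoot_jacobiPoly_iff (hα : -1 < α) (hβ : -1 < β) {k : ℕ} (hk : 1 ≤ k) {x : ℝ} :
    (jacobiPoly α β k).IsRoot x ↔ (jacobiMonic α β k).IsRoot x := by
  simp [jacobiPoly, IsRoot, (jacobiLeadingCoeff_pos hα hβ hk).ne']

theorem isLeast_jacobiSmallestRoot (hα : -1 < α) (hβ : -1 < β) {k : ℕ} (hk : 1 ≤ k) :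
    IsLeast {x : ℝ | (jacobiPoly α β k).IsRoot x} (jacobiSmallestRoot α β k) := by
  have hne : jacobiPoly α β k ≠ 0 :=
    mul_ne_zero (C_ne_zero.mpr (jacobiLeadingCoeff_pos hα hβ hk).ne')
      (jacobiMonic_monic α β k).ne_zero
  have hfin : {x : ℝ | (jacobiPoly α β k).IsRoot x}.Finite := finite_setOfPred_isRoot hne
  obtain ⟨x, hx⟩ := exists_isRoot_of_dvd_jacobiMonic hα hβ (k := k)
    (by rw [natDegree_jacobiMonic]; omega) dvd_rfl
  have hx' : x ∈ {x : ℝ | (jacobiPoly α β k).IsRoot x} := (isRoot_jacobiPoly_iff hα hβ hk).mpr hx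
  exact ⟨Set.Nonempty.csInf_mem ⟨x, hx'⟩ hfin, fun y hy => csInf_le hfin.bddBelow hy⟩

/-- Explicit bounds for the reciprocal distance of the smallest Jacobi root to `-1`. -/
theorem inv_one_add_jacobiSmallestRoot_bounds (hα : -1 < α) (hβ : -1 < β) {k : ℕ} (hk : 1 ≤ k) :
    -1 < jacobiSmallestRoot α β k ∧
    (1 + jacobiSmallestRoot α β k)⁻¹ ≤ k * (k + α + β + 1) / (2 * (β + 1)) ∧
    (k * (k + α + β + 1) + (β + 1) * (α + β + 2)) / (2 * (β + 1) * (β + 2)) ≤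
      (1 + jacobiSmallestRoot α β k)⁻¹ := by
  obtain ⟨hroot, hmin⟩ := isLeast_jacobiSmallestRoot hα hβ hk
  set ξ := jacobiSmallestRoot α β k
  have hP := (jacobiMonic_monic α β k).ne_zero
  have hξroot : (jacobiMonic α β k).IsRoot ξ := (isRoot_jacobiPoly_iff hα hβ hk).mp hroot
  have hξ := neg_one_lt_of_isRoot_jacobiMonic hα hβ hξroot
  have hgt : ∀ r ∈ (jacobiMonic α β k).roots, -1 < r := fun r hr =>
    neg_one_lt_of_isRoot_jacobiMonic hα hβ ((mem_roots hP).mp hr)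
  have hle : ∀ r ∈ (jacobiMonic α β k).roots, ξ ≤ r := fun r hr =>
    hmin ((isRoot_jacobiPoly_iff hα hβ hk).mpr ((mem_roots hP).mp hr))
  obtain ⟨h1, h2⟩ := sum_inv_one_add_roots_jacobiMonic hα hβ k
  refine ⟨hξ, ?_, ?_⟩
  · rw [← h1]
    refine Multiset.single_le_sum (fun y hy => ?_) _
      (Multiset.mem_map_of_mem (fun r : ℝ => (1 + r)⁻¹) ((mem_roots hP).mpr hξroot))
    obtain ⟨r, hr, rfl⟩ := Multiset.mem_map.mp hy
    exact inv_nonneg.mpr (by linarith [hgt r hr])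
  -- `T ≤ S/(1+ξ)`, since `1/(1+ξ)` is the largest term; then divide by `S`, positive as `k ≥ 1`.
  · have hsum : ((jacobiMonic α β k).roots.map fun r => (1 + r)⁻¹ ^ 2).sum ≤
        (1 + ξ)⁻¹ * ((jacobiMonic α β k).roots.map fun r => (1 + r)⁻¹).sum := by
      rw [← Multiset.sum_map_mul_left]
      refine Multiset.sum_map_le_sum_map _ _ fun r hr => ?_
      have hr1 := hgt r hr
      have hr2 := hle r hr
      rw [sq]
      exact mul_le_mul_of_nonneg_right (inv_anti₀ (by linarith) (by linarith))
        (inv_nonneg.mpr (by linarith))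
    rw [h1, h2, mul_comm _⁻¹] at hsum
    have hk1 : (1 : ℝ) ≤ k := by exact_mod_cast hk
    exact le_of_mul_le_mul_left hsum
      (div_pos (mul_pos (by linarith) (by linarith)) (by linarith))

end SmallestRoot

theorem corollary2p2 (α β : ℝ) (hα : -1 < α) (hβ : -1 < β) :
    (∀ k : ℕ, 1 ≤ k →
      IsLeast {x : ℝ | (jacobiPoly α β k).IsRoot x} (jacobiSmallestRoot α β k)) ∧
    ∃ c : ℝ, 0 < c ∧ ∃ C : ℝ, 0 < C ∧ ∀ᶠ k : ℕ in Filter.atTop,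
      -1 + c / (k : ℝ) ^ 2 ≤ jacobiSmallestRoot α β k ∧
      jacobiSmallestRoot α β k ≤ -1 + C / (k : ℝ) ^ 2 := by
  have hb : 0 < β + 1 := by linarith
  have hb2 : 0 < β + 2 := by linarith
  -- `c` comes from `S ≤ (1 + |α+β+1|) k² / (2(β+1))`. `C` comes from bounding the numerator of
  -- `T/S` below by `k²/2`, valid once `k ≥ 2|α+β+1|`.
  refine ⟨fun k hk => isLeast_jacobiSmallestRoot hα hβ hk,
    2 * (β + 1) / (1 + |α + β + 1|), by positivity, 4 * (β + 1) * (β + 2), by positivity, ?_⟩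
  filter_upwards [Filter.eventually_ge_atTop 1,
    Filter.eventually_ge_atTop ⌈2 * |α + β + 1|⌉₊] with k hk hk'
  obtain ⟨hξ, hu, hl⟩ := inv_one_add_jacobiSmallestRoot_bounds hα hβ hk
  set ξ := jacobiSmallestRoot α β k
  have hk1 : (1 : ℝ) ≤ k := by exact_mod_cast hk
  have hk2 : 2 * |α + β + 1| ≤ k := Nat.ceil_le.mp hk'
  have hξ1 : 0 < 1 + ξ := by linarith
  have habs := abs_nonneg (α + β + 1)
  have hupper : (k : ℝ) * (k + α + β + 1) ≤ (1 + |α + β + 1|) * (k : ℝ) ^ 2 := by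
    have h : (k : ℝ) + α + β + 1 ≤ (1 + |α + β + 1|) * k := by
      nlinarith [le_abs_self (α + β + 1)]
    nlinarith
  have hlower : (k : ℝ) ^ 2 / 2 ≤ k * (k + α + β + 1) + (β + 1) * (α + β + 2) := by
    have h : (k : ℝ) / 2 ≤ k + α + β + 1 := by linarith [neg_abs_le (α + β + 1)]
    have h' : 0 < (β + 1) * (α + β + 2) := mul_pos hb (by linarith)
    nlinarith
  constructor
  · have h : (1 + ξ)⁻¹ ≤ (2 * (β + 1) / (1 + |α + β + 1|) / (k : ℝ) ^ 2)⁻¹ := by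
      refine hu.trans ?_
      rw [inv_div, div_div_eq_mul_div, mul_comm]
      exact div_le_div_of_nonneg_right (by linarith) (by positivity)
    have := (inv_le_inv₀ hξ1 (by positivity)).mp h
    linarith
  · have h : (4 * (β + 1) * (β + 2) / (k : ℝ) ^ 2)⁻¹ ≤ (1 + ξ)⁻¹ := by
      refine le_trans ?_ hl
      rw [inv_div, div_le_div_iff₀ (by positivity) (by positivity)]
      nlinarith [mul_le_mul_of_nonneg_right hlower (by positivity : 0 ≤ 4 * (β + 1) * (β + 2))]
    have := (inv_le_inv₀ (by positivity) hξ1).mp h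
    linarith
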